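/- Notation. $D(r)=\{z\in\mathbb C:|z|<r\}$, $\overline D(r)=\{|z|\le r\}$, $\mathbb C^{\rm up}=\{\operatorname{Im}z>0\}$. A charge $\nu$ on $\mathbb C$ is a real-valued $\sigma$-additive function of bounded Borel sets (a real Radon measure, possibly of infinite total mass); $|\nu|$ is its total variation, $|\nu|^{\rm rad}(r):=|\nu|(\overline D(r))$, and its type at order $p\ge 0$ (near $\infty$) is ${\rm type}_p^\infty[\nu]:=\limsup_{r\to+\infty}|\nu|^{\rm rad}(r)/r^p$; $\nu$ is of finite type at order $p$ if this is $<+\infty$. For $q\in\{0,1,2,\dots\}$, $z\in\mathbb C^{\rm up}$ and bounded Borel $B\subset\mathbb C$ the harmonic charge of genus $q$ is $$\Omega^{[q]}(z,B):=\omega(z,B)+\frac1\pi\int_{B\cap\mathbb R}\operatorname{Im}\frac{t^q-z^q}{z^q(t-z)}\,dt,\qquad \omega(z,B)=\frac1\pi\int_{B\cap\mathbb R}\frac{\operatorname{Im}z}{|t-z|^2}\,dt,$$ where $\omega$ is the harmonic measure of $\mathbb C^{\rm up}$. The balayage of genus $q$ of $\nu$ from $\mathbb C^{\rm up}$ is the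 (unique) charge $\nu^{{\rm bal}[q]}$, when it exists, with $$\nu^{{\rm bal}[q]}(B)=\int_{\mathbb C^{\rm up}}\Omega^{[q]}(z,B)\,d\nu(z)+\nu(B\setminus\mathbb C^{\rm up})\quad\text{for every bounded Borel }B\subset\mathbb C,$$ the integrals being absolutely convergent. Theorem. Let $p\ge 0$ be real, $q:=[p]$ the integer part of $p$, and let $\nu$ be a charge on $\mathbb C$ of finite type at order $p$ with $0\notin\operatorname{supp}\nu$. Then the balayage $\nu^{{\rm bal}[q]}$ of genus $q$ from $\mathbb C^{\rm up}$ exists, and: 1. there is a constant $C$, depending only on $\nu$ and $p$, such that for every $r_0>0$ with $D(r_0)\cap\operatorname{supp}\nu=\varnothing$ and every $r\ge 0$ $$|\nu^{{\rm bal}[q]}|^{\rm rad}(r)\le C\Bigl(r^p+r^q\Bigl|\int_{\mathbb C^{\rm up}\cap D(r)\setminus D(r_0)}\operatorname{Im}\frac1{z^q}\,d\nu(z)\Bigr|\Bigr)$$ (with $0^0=1$); 2. $|\nu^{{\rm bal}[q]}|^{\rm rad}(r)=O(r^p\log r)$ as $r\to+\infty$; 3. if $p$ is not an integer, then ${\rm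 type}_p^\infty[\nu^{{\rm bal}[q]}]<+\infty$; 4. if $p$ is an integer (so $q=p$) and $\nu$ satisfies the Blaschke condition of genus $p$ in the upper half-plane, i.e. for some $r_0>0$ $$\Bigl|\int_{\{\operatorname{Im}z\ge 0\}\cap D(t)\setminus D(r_0)}\operatorname{Im}\frac1{z^q}\,d\nu(z)\Bigr|=O(1)\quad\text{as }t\to+\infty,$$ then ${\rm type}_p^\infty[\nu^{{\rm bal}[q]}]<+\infty$. -/

import Mathlib

open Set Filter Topology MeasureTheory Asymptotics Metric

/-- A (real) charge on `ℂ`: a real-valued function of bounded Borel sets that is σ-additive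
(whenever the union of the disjoint sequence is bounded). By convention the value is `0` on sets
that are not both bounded and Borel. Its total variation may be infinite on `ℂ`. -/
structure Charge where
  /-- the value on a set -/
  val : Set ℂ → ℝ
  val_empty : val ∅ = 0
  val_junk : ∀ B : Set ℂ, ¬ (MeasurableSet B ∧ Bornology.IsBounded B) → val B = 0
  hasSum_iUnion : ∀ A : ℕ → Set ℂ, (∀ i, MeasurableSet (A i)) →
    Pairwise (Function.onFun Disjoint A) → Bornology.IsBounded (⋃ i, A i) →
    HasSum (fun i => val (A i)) (val (⋃ i, A i))

namespace Charge

/-- The half-open annulus `n ≤ |z| < n + 1`. These annuli form a partition of `ℂ`. -/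
def annulus (n : ℕ) : Set ℂ := {z | (n : ℝ) ≤ ‖z‖ ∧ ‖z‖ < n + 1}

theorem measurableSet_annulus (n : ℕ) : MeasurableSet (annulus n) :=
  (measurableSet_le measurable_const measurable_norm).inter
    (measurableSet_lt measurable_norm measurable_const)

theorem isBounded_annulus (n : ℕ) : Bornology.IsBounded (annulus n) :=
  (Metric.isBounded_ball (x := (0 : ℂ)) (r := n + 1)).subset fun z hz => by
    simpa [Metric.mem_ball, dist_zero_right] using hz.2

theorem iUnion_annulus : ⋃ n, annulus n = univ :=
  eq_univ_of_forall fun z => mem_iUnion.2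
    ⟨⌊‖z‖⌋₊, Nat.floor_le (norm_nonneg z), Nat.lt_floor_add_one ‖z‖⟩

theorem pairwise_disjoint_annulus : Pairwise (Function.onFun Disjoint annulus) := by
  intro m n hmn
  rw [Function.onFun, Set.disjoint_left]
  rintro z ⟨h1, h2⟩ ⟨h3, h4⟩
  have h5 : m < n + 1 := by exact_mod_cast h1.trans_lt h4
  have h6 : n < m + 1 := by exact_mod_cast h3.trans_lt h2
  omega

open Classical in
/-- The restriction of a charge to an annulus is a finite signed measure. -/
noncomputable def piece (ν : Charge) (n : ℕ) : SignedMeasure ℂ where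
  measureOf' B := if MeasurableSet B then ν.val (B ∩ annulus n) else 0
  empty' := by simp [ν.val_empty]
  not_measurable' B hB := by simp [hB]
  m_iUnion' A hA hd := by
    simp only [hA, MeasurableSet.iUnion hA, if_true, iUnion_inter]
    refine ν.hasSum_iUnion _ (fun i => (hA i).inter (measurableSet_annulus n)) ?_ ?_
    · intro i j hij
      exact (hd hij).mono inter_subset_left inter_subset_left
    · exact (isBounded_annulus n).subset (iUnion_subset fun i => inter_subset_right)

theorem piece_apply (ν : Charge) (n : ℕ) {B : Set ℂ} (hB : MeasurableSet B) :
    ν.piece n B = ν.val (B ∩ annulus n) := if_pos hB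

/-- The upper (positive) variation `ν⁺`, glued from the Jordan decompositions on the annuli. -/
noncomputable def posVar (ν : Charge) : Measure ℂ :=
  Measure.sum fun n => (ν.piece n).toJordanDecomposition.posPart

/-- The lower (negative) variation `ν⁻`. -/
noncomputable def negVar (ν : Charge) : Measure ℂ :=
  Measure.sum fun n => (ν.piece n).toJordanDecomposition.negPart

/-- The total variation `|ν| = ν⁺ + ν⁻`. -/
noncomputable def totalVar (ν : Charge) : Measure ℂ := ν.posVar + ν.negVar

theorem jordan_eq_zero (ν : Charge) {n : ℕ} {B : Set ℂ} (hB : MeasurableSet B)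
    (h : B ∩ annulus n = ∅) :
    (ν.piece n).toJordanDecomposition.posPart B = 0 ∧
      (ν.piece n).toJordanDecomposition.negPart B = 0 := by
  obtain ⟨i, hi, h1, h2, h3, h4⟩ := (ν.piece n).toJordanDecomposition_spec
  have key : ∀ s : Set ℂ, MeasurableSet s → s ⊆ B → ν.piece n s = 0 := by
    intro s hs hsB
    rw [ν.piece_apply n hs, subset_empty_iff.1 ((inter_subset_inter_left _ hsB).trans h.subset),
      ν.val_empty]
  constructor
  · rw [h3, SignedMeasure.toMeasureOfZeroLE_apply _ h1 hi hB]
    simp [key _ (hi.inter hB) inter_subset_right]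
  · rw [h4, SignedMeasure.toMeasureOfLEZero_apply _ h2 hi.compl hB]
    simp [key _ (hi.compl.inter hB) inter_subset_right]

theorem inter_annulus_eq_empty {B : Set ℂ} {N n : ℕ} (hB : B ⊆ ball 0 N) (hn : N ≤ n) :
    B ∩ annulus n = ∅ := by
  rw [← disjoint_iff_inter_eq_empty, Set.disjoint_left]
  rintro z hz ⟨h1, -⟩
  have h2 : ‖z‖ < N := by simpa [dist_zero_right] using hB hz
  have h3 : (N : ℝ) ≤ n := by exact_mod_cast hn
  linarith

theorem exists_subset_ball {B : Set ℂ} (hB : Bornology.IsBounded B) :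
    ∃ N : ℕ, B ⊆ ball (0 : ℂ) N := by
  obtain ⟨r, hr⟩ := hB.subset_ball (0 : ℂ)
  obtain ⟨N, hN⟩ := exists_nat_gt r
  exact ⟨N, hr.trans (ball_subset_ball hN.le)⟩

theorem posVar_apply (ν : Charge) {B : Set ℂ} {N : ℕ} (hm : MeasurableSet B)
    (hB : B ⊆ ball 0 N) :
    ν.posVar B = ∑ n ∈ Finset.range N, (ν.piece n).toJordanDecomposition.posPart B := by
  rw [posVar, Measure.sum_apply _ hm]
  refine tsum_eq_sum fun n hn => (ν.jordan_eq_zero hm ?_).1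
  exact inter_annulus_eq_empty hB (by simpa using hn)

theorem negVar_apply (ν : Charge) {B : Set ℂ} {N : ℕ} (hm : MeasurableSet B)
    (hB : B ⊆ ball 0 N) :
    ν.negVar B = ∑ n ∈ Finset.range N, (ν.piece n).toJordanDecomposition.negPart B := by
  rw [negVar, Measure.sum_apply _ hm]
  refine tsum_eq_sum fun n hn => (ν.jordan_eq_zero hm ?_).2
  exact inter_annulus_eq_empty hB (by simpa using hn)

/-- The total variation of a charge is finite on bounded sets. -/
theorem totalVar_lt_top (ν : Charge) {B : Set ℂ} (hB : Bornology.IsBounded B) :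
    ν.totalVar B < ⊤ := by
  obtain ⟨N, hN⟩ := exists_subset_ball hB
  refine (measure_mono hN).trans_lt ?_
  rw [totalVar, Measure.add_apply, ν.posVar_apply measurableSet_ball subset_rfl,
    ν.negVar_apply measurableSet_ball subset_rfl]
  exact ENNReal.add_lt_top.2 ⟨ENNReal.sum_lt_top.2 fun _ _ => measure_lt_top _ _,
    ENNReal.sum_lt_top.2 fun _ _ => measure_lt_top _ _⟩

/-- On bounded Borel sets `ν = ν⁺ - ν⁻`. -/
theorem val_eq_sub (ν : Charge) {B : Set ℂ} (hm : MeasurableSet B)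
    (hB : Bornology.IsBounded B) : ν.val B = ν.posVar.real B - ν.negVar.real B := by
  obtain ⟨N, hN⟩ := exists_subset_ball hB
  have h1 : HasSum (fun n => ν.val (B ∩ annulus n)) (ν.val B) := by
    have h := ν.hasSum_iUnion (fun n => B ∩ annulus n)
      (fun n => hm.inter (measurableSet_annulus n))
      (fun i j hij => (pairwise_disjoint_annulus hij).mono inter_subset_right inter_subset_right)
      (hB.subset (iUnion_subset fun n => inter_subset_left))
    rwa [← inter_iUnion, iUnion_annulus, inter_univ] at h
  have h2 : HasSum (fun n => ν.val (B ∩ annulus n))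
      (∑ n ∈ Finset.range N, ν.val (B ∩ annulus n)) :=
    hasSum_sum_of_ne_finset_zero fun n hn => by
      rw [inter_annulus_eq_empty hN (by simpa using hn), ν.val_empty]
  rw [h1.unique h2, Measure.real, Measure.real, ν.posVar_apply hm hN, ν.negVar_apply hm hN,
    ENNReal.toReal_sum fun _ _ => measure_ne_top _ _,
    ENNReal.toReal_sum fun _ _ => measure_ne_top _ _, ← Finset.sum_sub_distrib]
  refine Finset.sum_congr rfl fun n _ => ?_
  rw [← ν.piece_apply n hm, ← Measure.real, ← Measure.real]
  conv_lhs => rw [← (ν.piece n).toSignedMeasure_toJordanDecomposition]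
  rw [JordanDecomposition.toSignedMeasure, sub_apply,
    Measure.toSignedMeasure_apply_measurable hm, Measure.toSignedMeasure_apply_measurable hm]

/-- A charge is determined by its values on bounded Borel sets. -/
theorem ext_of_bounded {ν μ : Charge}
    (h : ∀ B, MeasurableSet B → Bornology.IsBounded B → ν.val B = μ.val B) : ν = μ := by
  have : ν.val = μ.val := by
    funext B
    by_cases hB : MeasurableSet B ∧ Bornology.IsBounded B
    · exact h B hB.1 hB.2
    · rw [ν.val_junk B hB, μ.val_junk B hB]
  cases ν; cases μ; cases this; rfl

/-- The support of a charge, i.e. the closed support of its total variation. -/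
noncomputable def supp (ν : Charge) : Set ℂ := ν.totalVar.support

/-- The integral `∫_S f dν = ∫_S f dν⁺ - ∫_S f dν⁻` of a function over a set against a charge. -/
noncomputable def setIntegral (ν : Charge) (S : Set ℂ) (f : ℂ → ℝ) : ℝ :=
  (∫ z in S, f z ∂ν.posVar) - ∫ z in S, f z ∂ν.negVar

/-- `|ν|^rad (r) = |ν|(closed disc of radius r)`. -/
noncomputable def radVar (ν : Charge) (r : ℝ) : ℝ := ν.totalVar.real (closedBall 0 r)

/-- The type `limsup_{r → +∞} |ν|^rad (r) / r^p` of a charge at order `p` near infinity. -/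
noncomputable def typeAt (ν : Charge) (p : ℝ) : EReal :=
  limsup (fun r : ℝ => ((ν.radVar r / r ^ p : ℝ) : EReal)) atTop

end Charge

/-- The open upper half-plane. -/
def openUpper : Set ℂ := {z | 0 < z.im}

/-- The closed upper half-plane. -/
def closedUpper : Set ℂ := {z | 0 ≤ z.im}

/-- The trace `B ∩ ℝ` of a plane set on the real axis, as a set of reals. -/
def realTrace (B : Set ℂ) : Set ℝ := {t : ℝ | (t : ℂ) ∈ B}

/-- The harmonic measure `ω(z, B)` of (the real trace of) `B` for the upper half-plane at `z`. -/
noncomputable def harmonicMeas (z : ℂ) (B : Set ℂ) : ℝ :=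
  (1 / Real.pi) * ∫ t in realTrace B, z.im / ((t - z.re) ^ 2 + z.im ^ 2)

/-- The harmonic charge `Ω^[q](z, B)` of genus `q` for the upper half-plane. -/
noncomputable def harmonicCharge (q : ℕ) (z : ℂ) (B : Set ℂ) : ℝ :=
  harmonicMeas z B + (1 / Real.pi) *
    ∫ t in realTrace B, (((t : ℂ) ^ q - z ^ q) / (z ^ q * ((t : ℂ) - z))).im

/-- `β` is the balayage of genus `q` of the charge `ν` from the upper half-plane onto the closed
lower half-plane: for every bounded Borel set `B` the integral of `Ω^[q](·, B)` over the open
upper half-plane against `ν` converges absolutely, and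
`β(B) = ∫_{Im z > 0} Ω^[q](z, B) dν(z) + ν(B ∩ {Im z ≤ 0})`. -/
def IsBalayage (q : ℕ) (ν β : Charge) : Prop :=
  ∀ B : Set ℂ, MeasurableSet B → Bornology.IsBounded B →
    IntegrableOn (fun z => harmonicCharge q z B) openUpper ν.totalVar ∧
    β.val B = ν.setIntegral openUpper (fun z => harmonicCharge q z B) + ν.val (B ∩ openUpperᶜ)

/-- The balayage of genus `q` of a charge is unique. -/
theorem IsBalayage.unique {q : ℕ} {ν β γ : Charge} (h : IsBalayage q ν β)
    (h' : IsBalayage q ν γ) : β = γ :=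
  Charge.ext_of_bounded fun B hm hb => (h B hm hb).2.trans (h' B hm hb).2.symm

/-!
The density of the harmonic charge of genus `q` at `z` is
`K_q(z, t) = (1 / π) Im (t ^ q / (z ^ q (t - z)))` (`harmonicCharge_eq_integral`); in genus `0` it is
the Poisson kernel, of total mass `1`. The balayage is therefore the part of `ν` outside the open
upper half-plane plus the measure on the real axis with density `f(t) = ∫ K_q(z, t) dν(z)`
(`balDensity`), provided that `K_q` is absolutely integrable on the product of the upper half-plane
with every bounded interval (`integrableOn_balKernel`, `isBalayage_of_balDensity`). Since the total
variation is the least measure dominating a charge (`Charge.totalVar_le_of_forall_enorm_le`), the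
growth of the balayage reduces to the growth of `∫ |f|` over `[-r, r]`.

Everything rests on the identity `K_{m+1}(z, t) = K_m(z, t) + (1 / π) t ^ m Im z ^ (-m-1)`
(`balKernel_succ`). Iterated from the Poisson kernel, it bounds the mass of `K_m(z, ·)` on
`[-r, r]` by a multiple of `(r / |z|) ^ m` for `|z| ≤ r`; for `|z| ≥ r` the mass is bounded by a
multiple of `(r / |z|) ^ (m + 1)`. A charge of finite type at order `p` vanishing near `0` satisfies
`|ν|(closedBall 0 R) ≤ A R ^ p` for all `R > 0`, so by summation over dyadic shells
`∫_{|z| ≥ r} (r / |z|) ^ (q + 1) d|ν| = O(r ^ p)` because `q + 1 > p`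
(`exists_lintegral_tail_le`), and `∫_{|z| < r} (r / |z|) ^ (q - 1) d|ν| = O(r ^ p)` because
`q - 1 < p` (`exists_lintegral_core_le`). On the disc of radius `r` the exponent `q` may be
critical, and there one application of the identity replaces `K_q` by `K_{q-1}` at the price of the
term `t ^ (q - 1) ∫ Im z ^ (-q) dν`, integrated over the half-disc without absolute values
(`exists_lintegral_balDensity_le`). This is the first estimate. The others follow by bounding the
last integral: by `O(r ^ (p - q))` if `q < p`, by a logarithm if `q = p`, where each dyadic shell
contributes a bounded amount (`exists_lintegral_le_log`), and by a constant under the Blaschke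
condition.
-/

/-! ### Charges and their total variation -/

namespace Charge

instance (ν : Charge) : SFinite ν.posVar := by unfold posVar; infer_instance
instance (ν : Charge) : SFinite ν.negVar := by unfold negVar; infer_instance
instance (ν : Charge) : SFinite ν.totalVar := by unfold totalVar; infer_instance

theorem totalVar_eq_sum (ν : Charge) :
    ν.totalVar = Measure.sum fun n => (ν.piece n).variation := by
  rw [totalVar, posVar, negVar, Measure.sum_add_sum]
  simp only [← SignedMeasure.totalVariation_eq_variation, SignedMeasure.totalVariation]

/-- The total variation is the least measure that dominates the charge. -/
theorem totalVar_le_of_forall_enorm_le (ν : Charge) {m : Measure ℂ}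
    (h : ∀ B, MeasurableSet B → Bornology.IsBounded B → ‖ν.val B‖ₑ ≤ m B) : ν.totalVar ≤ m := by
  have hm : m = Measure.sum fun n => m.restrict (annulus n) := by
    rw [← Measure.restrict_iUnion pairwise_disjoint_annulus measurableSet_annulus,
      iUnion_annulus, Measure.restrict_univ]
  rw [totalVar_eq_sum, hm]
  refine Measure.le_iff.2 fun s hs => ?_
  rw [Measure.sum_apply _ hs, Measure.sum_apply _ hs]
  refine ENNReal.tsum_le_tsum fun n => ?_
  refine VectorMeasure.variation_le_of_forall_enorm_le (m := m.restrict (annulus n))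
    (fun E hE => ?_) s
  rw [ν.piece_apply n hE, Measure.restrict_apply hE]
  exact h _ (hE.inter (measurableSet_annulus n))
    ((isBounded_annulus n).subset inter_subset_right)

theorem posVar_le_totalVar (ν : Charge) : ν.posVar ≤ ν.totalVar := Measure.le_add_right le_rfl

theorem negVar_le_totalVar (ν : Charge) : ν.negVar ≤ ν.totalVar := Measure.le_add_left le_rfl

theorem enorm_val_le (ν : Charge) {B : Set ℂ} (hm : MeasurableSet B)
    (hB : Bornology.IsBounded B) : ‖ν.val B‖ₑ ≤ ν.totalVar B := by
  have hfin := ν.totalVar_lt_top hB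
  have h1 : ν.posVar B ≠ ⊤ := ((ν.posVar_le_totalVar B).trans_lt hfin).ne
  have h2 : ν.negVar B ≠ ⊤ := ((ν.negVar_le_totalVar B).trans_lt hfin).ne
  rw [ν.val_eq_sub hm hB, totalVar, Measure.add_apply]
  refine enorm_sub_le.trans (add_le_add ?_ ?_)
  · rw [Real.enorm_of_nonneg measureReal_nonneg, ofReal_measureReal h1]
  · rw [Real.enorm_of_nonneg measureReal_nonneg, ofReal_measureReal h2]

theorem radVar_nonneg (ν : Charge) (r : ℝ) : 0 ≤ ν.radVar r := measureReal_nonneg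

theorem ofReal_radVar (ν : Charge) (r : ℝ) :
    ENNReal.ofReal (ν.radVar r) = ν.totalVar (closedBall 0 r) :=
  ofReal_measureReal (ν.totalVar_lt_top isBounded_closedBall).ne

/-- An integral against a charge is dominated by the integral against its total variation. This
holds without any integrability hypothesis, since the right-hand side is infinite otherwise. -/
theorem enorm_setIntegral_le (ν : Charge) (S : Set ℂ) (f : ℂ → ℝ) :
    ‖ν.setIntegral S f‖ₑ ≤ ∫⁻ z in S, ‖f z‖ₑ ∂ν.totalVar := by
  rw [setIntegral, totalVar, Measure.restrict_add, lintegral_add_measure]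
  exact enorm_sub_le.trans
    (add_le_add (enorm_integral_le_lintegral_enorm _) (enorm_integral_le_lintegral_enorm _))

theorem setIntegral_congr_set (ν : Charge) {S T : Set ℂ} (f : ℂ → ℝ)
    (h : S =ᵐ[ν.totalVar] T) : ν.setIntegral S f = ν.setIntegral T f := by
  rw [setIntegral, setIntegral,
    MeasureTheory.setIntegral_congr_set (ae_mono ν.posVar_le_totalVar h),
    MeasureTheory.setIntegral_congr_set (ae_mono ν.negVar_le_totalVar h)]

theorem setIntegral_add (ν : Charge) {S : Set ℂ} {f g : ℂ → ℝ}
    (hf : IntegrableOn f S ν.totalVar) (hg : IntegrableOn g S ν.totalVar) :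
    ν.setIntegral S (fun z => f z + g z) = ν.setIntegral S f + ν.setIntegral S g := by
  simp only [setIntegral]
  rw [integral_add (hf.mono_measure ν.posVar_le_totalVar) (hg.mono_measure ν.posVar_le_totalVar),
    integral_add (hf.mono_measure ν.negVar_le_totalVar) (hg.mono_measure ν.negVar_le_totalVar)]
  ring

theorem setIntegral_union (ν : Charge) {S T : Set ℂ} {f : ℂ → ℝ} (h : Disjoint S T)
    (hT : MeasurableSet T) (hfS : IntegrableOn f S ν.totalVar)
    (hfT : IntegrableOn f T ν.totalVar) :
    ν.setIntegral (S ∪ T) f = ν.setIntegral S f + ν.setIntegral T f := by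
  simp only [setIntegral]
  rw [MeasureTheory.setIntegral_union h hT (hfS.mono_measure ν.posVar_le_totalVar)
      (hfT.mono_measure ν.posVar_le_totalVar),
    MeasureTheory.setIntegral_union h hT (hfS.mono_measure ν.negVar_le_totalVar)
      (hfT.mono_measure ν.negVar_le_totalVar)]
  ring

theorem setIntegral_eq_of_subset_of_forall_diff_eq_zero (ν : Charge) {S T : Set ℂ} {f : ℂ → ℝ}
    (hT : MeasurableSet T) (hST : S ⊆ T) (h : ∀ z ∈ T \ S, f z = 0) :
    ν.setIntegral T f = ν.setIntegral S f := by
  simp only [setIntegral]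
  rw [MeasureTheory.setIntegral_eq_of_subset_of_forall_sdiff_eq_zero hT hST h,
    MeasureTheory.setIntegral_eq_of_subset_of_forall_sdiff_eq_zero hT hST h]

theorem setIntegral_indicator_const_mul (ν : Charge) (S : Set ℂ) {T : Set ℂ}
    (hT : MeasurableSet T) (f : ℂ → ℝ) (a : ℝ) :
    ν.setIntegral S (T.indicator fun z => a * f z) = a * ν.setIntegral (T ∩ S) f := by
  simp only [setIntegral]
  rw [integral_indicator hT, integral_indicator hT, Measure.restrict_restrict hT,
    Measure.restrict_restrict hT, integral_const_mul, integral_const_mul, mul_sub]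

theorem typeAt_lt_top_of_eventually_le (ν : Charge) {p A : ℝ}
    (h : ∀ᶠ r in atTop, ν.radVar r ≤ A * r ^ p) : ν.typeAt p < ⊤ := by
  refine lt_of_le_of_lt (limsup_le_of_le (a := (A : EReal)) (by isBoundedDefault) ?_)
    (EReal.coe_lt_top A)
  filter_upwards [h, eventually_gt_atTop 0] with r hr h0
  exact EReal.coe_le_coe_iff.2 ((div_le_iff₀ (Real.rpow_pos_of_pos h0 p)).2 hr)

theorem totalVar_eq_zero_of_disjoint_supp (ν : Charge) {S : Set ℂ} (h : Disjoint S ν.supp) :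
    ν.totalVar S = 0 :=
  measure_mono_null h.subset_compl_right Measure.measure_compl_support

theorem exists_ball_disjoint_supp (ν : Charge) (h0 : (0 : ℂ) ∉ ν.supp) :
    ∃ ε : ℝ, 0 < ε ∧ Disjoint (ball (0 : ℂ) ε) ν.supp := by
  obtain ⟨ε, hε, h⟩ := Metric.isOpen_iff.1
    (Measure.isOpen_compl_support (μ := ν.totalVar)) 0 h0
  exact ⟨ε, hε, disjoint_left.2 fun z hz => h hz⟩

/-- A charge of finite type at order `p` that vanishes near the origin grows at most like `R ^ p`
on all discs, not only on the large ones. -/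
theorem exists_totalVar_closedBall_le (ν : Charge) {p : ℝ} (hp : 0 ≤ p) (hν : ν.typeAt p < ⊤)
    (h0 : (0 : ℂ) ∉ ν.supp) :
    ∃ A : ℝ, 0 ≤ A ∧ ∀ R : ℝ, 0 < R →
      ν.totalVar (closedBall 0 R) ≤ ENNReal.ofReal (A * R ^ p) := by
  obtain ⟨ε, hε, hd⟩ := ν.exists_ball_disjoint_supp h0
  obtain ⟨a, ha, -⟩ := EReal.lt_iff_exists_real_btwn.1 hν
  obtain ⟨R₁, hR₁⟩ := eventually_atTop.1
    (eventually_lt_of_limsup_lt (f := atTop) ha (by isBoundedDefault))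
  refine ⟨|a| + ν.radVar R₁ / ε ^ p, by have := ν.radVar_nonneg R₁; positivity, fun R hR => ?_⟩
  have hRp : 0 < R ^ p := Real.rpow_pos_of_pos hR p
  have hεp : 0 < ε ^ p := Real.rpow_pos_of_pos hε p
  have hR₁0 := ν.radVar_nonneg R₁
  rcases lt_or_ge R ε with h | h
  · rw [ν.totalVar_eq_zero_of_disjoint_supp (hd.mono_left (closedBall_subset_ball h))]
    exact zero_le
  rw [← ν.ofReal_radVar]
  refine ENNReal.ofReal_le_ofReal ?_
  rw [add_mul]
  rcases le_or_gt R₁ R with h' | h'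
  · have h1 := (div_lt_iff₀ hRp).1 (EReal.coe_lt_coe_iff.1 (hR₁ R h'))
    have h2 : a * R ^ p ≤ |a| * R ^ p := by gcongr; exact le_abs_self a
    have h3 : 0 ≤ ν.radVar R₁ / ε ^ p * R ^ p := by positivity
    linarith
  · have h1 : ν.radVar R ≤ ν.radVar R₁ :=
      measureReal_mono (closedBall_subset_closedBall h'.le)
        (ν.totalVar_lt_top isBounded_closedBall).ne
    have h2 : ν.radVar R₁ / ε ^ p * ε ^ p ≤ ν.radVar R₁ / ε ^ p * R ^ p := by gcongr
    rw [div_mul_cancel₀ _ hεp.ne'] at h2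
    have h3 : 0 ≤ |a| * R ^ p := by positivity
    linarith

end Charge

/-! ### Radial integrals against a measure of power growth -/

section Radial

variable {μ : Measure ℂ} {A p : ℝ}

/-- The integral over one dyadic shell, the building block of the three estimates below. -/
theorem lintegral_shell_le
    (hμ : ∀ R : ℝ, 0 < R → μ (closedBall 0 R) ≤ ENNReal.ofReal (A * R ^ p)) (s : ℕ) {R a : ℝ}
    (hR : 0 ≤ R) (ha : 0 < a) :
    ∫⁻ z in {z : ℂ | a ≤ ‖z‖ ∧ ‖z‖ ≤ 2 * a}, ENNReal.ofReal ((R / ‖z‖) ^ s) ∂μ ≤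
      ENNReal.ofReal ((R / a) ^ s * (A * (2 * a) ^ p)) := by
  have hS : MeasurableSet {z : ℂ | a ≤ ‖z‖ ∧ ‖z‖ ≤ 2 * a} :=
    (measurableSet_le measurable_const measurable_norm).inter
      (measurableSet_le measurable_norm measurable_const)
  calc ∫⁻ z in {z : ℂ | a ≤ ‖z‖ ∧ ‖z‖ ≤ 2 * a}, ENNReal.ofReal ((R / ‖z‖) ^ s) ∂μ
      ≤ ∫⁻ _ in {z : ℂ | a ≤ ‖z‖ ∧ ‖z‖ ≤ 2 * a}, ENNReal.ofReal ((R / a) ^ s) ∂μ := by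
        refine setLIntegral_mono' hS fun z hz => ENNReal.ofReal_le_ofReal ?_
        gcongr
        exact hz.1
    _ = ENNReal.ofReal ((R / a) ^ s) * μ {z : ℂ | a ≤ ‖z‖ ∧ ‖z‖ ≤ 2 * a} :=
        setLIntegral_const _ _
    _ ≤ ENNReal.ofReal ((R / a) ^ s) * ENNReal.ofReal (A * (2 * a) ^ p) := by
        gcongr
        refine (measure_mono fun z hz => ?_).trans (hμ (2 * a) (by positivity))
        simpa using hz.2
    _ = _ := (ENNReal.ofReal_mul (by positivity)).symm

theorem lintegral_iUnion_shell_le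
    (hμ : ∀ R : ℝ, 0 < R → μ (closedBall 0 R) ≤ ENNReal.ofReal (A * R ^ p)) (s : ℕ) {R : ℝ}
    (hR : 0 ≤ R) {a : ℕ → ℝ} (ha : ∀ k, 0 < a k) {c ρ : ℝ} (hc : 0 ≤ c) (hρ : 0 ≤ ρ)
    (hρ1 : ρ < 1) (h : ∀ k, (R / a k) ^ s * (A * (2 * a k) ^ p) = c * ρ ^ k) :
    ∫⁻ z in ⋃ k, {z : ℂ | a k ≤ ‖z‖ ∧ ‖z‖ ≤ 2 * a k}, ENNReal.ofReal ((R / ‖z‖) ^ s) ∂μ ≤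
      ENNReal.ofReal (c * (1 - ρ)⁻¹) := by
  refine (lintegral_iUnion_le _ _).trans ?_
  refine (ENNReal.tsum_le_tsum fun k => lintegral_shell_le hμ s hR (ha k)).trans ?_
  simp only [h]
  rw [← ENNReal.ofReal_tsum_of_nonneg (fun k => by positivity)
    ((summable_geometric_of_lt_one hρ hρ1).mul_left c), tsum_mul_left,
    tsum_geometric_of_lt_one hρ hρ1]

theorem exists_lintegral_tail_le (hA : 0 ≤ A)
    (hμ : ∀ R : ℝ, 0 < R → μ (closedBall 0 R) ≤ ENNReal.ofReal (A * R ^ p)) {s : ℕ}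
    (hs : p < s) :
    ∃ C : ℝ, 0 ≤ C ∧ ∀ R : ℝ, 0 < R →
      ∫⁻ z in {z : ℂ | R ≤ ‖z‖}, ENNReal.ofReal ((R / ‖z‖) ^ s) ∂μ ≤
        ENNReal.ofReal (C * R ^ p) := by
  have h2p : (0 : ℝ) < 2 ^ p := by positivity
  have hρ : (2 : ℝ) ^ p / 2 ^ s < 1 := by
    rw [div_lt_one (by positivity), ← Real.rpow_natCast]
    exact Real.rpow_lt_rpow_of_exponent_lt one_lt_two hs
  have hρ' : 0 < 1 - (2 : ℝ) ^ p / 2 ^ s := sub_pos.2 hρ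
  refine ⟨A * 2 ^ p * (1 - 2 ^ p / 2 ^ s)⁻¹, by positivity, fun R hR => ?_⟩
  have hsub : {z : ℂ | R ≤ ‖z‖} ⊆ ⋃ k : ℕ, {z : ℂ | 2 ^ k * R ≤ ‖z‖ ∧ ‖z‖ ≤ 2 * (2 ^ k * R)} := by
    intro z hz
    obtain ⟨k, hk, hk'⟩ := exists_nat_pow_near ((one_le_div hR).2 hz) one_lt_two
    refine mem_iUnion.2 ⟨k, (le_div_iff₀ hR).1 hk, ?_⟩
    have := (div_lt_iff₀ hR).1 hk'
    rw [pow_succ] at this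
    linarith
  refine (lintegral_mono_set hsub).trans ((lintegral_iUnion_shell_le hμ s hR.le
    (c := A * 2 ^ p * R ^ p) (fun k => by positivity) (by positivity) (by positivity) hρ
    fun k => ?_).trans_eq ?_)
  · rw [Real.mul_rpow two_pos.le (by positivity), Real.mul_rpow (by positivity) hR.le,
      ← Real.rpow_natCast_mul two_pos.le, mul_comm (k : ℝ), Real.rpow_mul_natCast two_pos.le]
    have : R / (2 ^ k * R) = (2 ^ k)⁻¹ := by field_simp
    rw [this, div_pow, inv_pow, ← pow_mul, ← pow_mul, mul_comm k s]
    field_simp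
  · ring_nf

theorem exists_lintegral_core_le (hA : 0 ≤ A)
    (hμ : ∀ R : ℝ, 0 < R → μ (closedBall 0 R) ≤ ENNReal.ofReal (A * R ^ p)) {s : ℕ}
    (hs : s = 0 ∨ s < p) :
    ∃ C : ℝ, 0 ≤ C ∧ ∀ R : ℝ, 0 < R →
      ∫⁻ z in ball 0 R, ENNReal.ofReal ((R / ‖z‖) ^ s) ∂μ ≤ ENNReal.ofReal (C * R ^ p) := by
  rcases Nat.eq_zero_or_pos s with rfl | hs0
  · refine ⟨A, hA, fun R hR => ?_⟩
    simpa using (measure_mono ball_subset_closedBall).trans (hμ R hR)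
  replace hs : (s : ℝ) < p := hs.resolve_left hs0.ne'
  have h2p : (0 : ℝ) < 2 ^ p := by positivity
  have hρ : (2 : ℝ) ^ s / 2 ^ p < 1 := by
    rw [div_lt_one (by positivity), ← Real.rpow_natCast]
    exact Real.rpow_lt_rpow_of_exponent_lt one_lt_two hs
  have hρ' : 0 < 1 - (2 : ℝ) ^ s / 2 ^ p := sub_pos.2 hρ
  refine ⟨A * 2 ^ s * (1 - 2 ^ s / 2 ^ p)⁻¹, by positivity, fun R hR => ?_⟩
  have hsub : ball (0 : ℂ) R ⊆ {0} ∪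
      ⋃ k : ℕ, {z : ℂ | R / 2 ^ (k + 1) ≤ ‖z‖ ∧ ‖z‖ ≤ 2 * (R / 2 ^ (k + 1))} := by
    intro z hz
    rcases eq_or_ne z 0 with rfl | hz0
    · exact Or.inl rfl
    have hzn : 0 < ‖z‖ := norm_pos_iff.2 hz0
    rw [mem_ball_zero_iff] at hz
    obtain ⟨k, hk, hk'⟩ := exists_nat_pow_near ((one_le_div hzn).2 hz.le) one_lt_two
    refine Or.inr (mem_iUnion.2 ⟨k, ?_, ?_⟩)
    · rw [div_le_iff₀ (by positivity)]
      linarith [(div_lt_iff₀ hzn).1 hk']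
    · have h1 := (le_div_iff₀ hzn).1 hk
      have h2 : 2 * (R / 2 ^ (k + 1)) = R / 2 ^ k := by rw [pow_succ]; field_simp
      rw [h2, le_div_iff₀ (by positivity)]
      linarith
  refine (lintegral_mono_set hsub).trans ((lintegral_union_le _ _ _).trans ?_)
  have hz : ∫⁻ z in {(0 : ℂ)}, ENNReal.ofReal ((R / ‖z‖) ^ s) ∂μ = 0 := by
    simp [Measure.restrict_singleton, hs0.ne']
  rw [hz, zero_add]
  refine ((lintegral_iUnion_shell_le hμ s hR.le
    (c := A * 2 ^ s * R ^ p) (fun k => by positivity) (by positivity) (by positivity) hρ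
    fun k => ?_).trans_eq ?_)
  · have h2 : 2 * (R / 2 ^ (k + 1)) = R / 2 ^ k := by rw [pow_succ]; field_simp
    have h3 : R / (R / 2 ^ (k + 1)) = 2 ^ (k + 1) := by field_simp
    rw [h2, h3, Real.div_rpow hR.le (by positivity),
      ← Real.rpow_natCast_mul two_pos.le, mul_comm (k : ℝ), Real.rpow_mul_natCast two_pos.le,
      div_pow, pow_succ, mul_pow, ← pow_mul, ← pow_mul, mul_comm k s]
    field_simp
  · ring_nf

/-- At the critical exponent every dyadic shell contributes the same amount, so that the integral
grows logarithmically. -/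
theorem exists_lintegral_le_log (hA : 0 ≤ A) {q : ℕ}
    (hμ : ∀ R : ℝ, 0 < R → μ (closedBall 0 R) ≤ ENNReal.ofReal (A * R ^ (q : ℝ))) {ε : ℝ}
    (hε : 0 < ε) :
    ∃ C : ℝ, 0 ≤ C ∧ ∀ᶠ R : ℝ in atTop,
      ∫⁻ z in {z : ℂ | ε ≤ ‖z‖ ∧ ‖z‖ ≤ R}, ENNReal.ofReal ((R / ‖z‖) ^ q) ∂μ ≤
        ENNReal.ofReal (C * (R ^ q * Real.log R)) := by
  have hdy : ∀ R : ℝ, 0 ≤ R → ∀ N : ℕ,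
      ∫⁻ z in {z : ℂ | ε ≤ ‖z‖ ∧ ‖z‖ < 2 ^ N * ε}, ENNReal.ofReal ((R / ‖z‖) ^ q) ∂μ ≤
        ENNReal.ofReal (N * (A * 2 ^ q * R ^ q)) := by
    intro R hR N
    induction N with
    | zero =>
      have : {z : ℂ | ε ≤ ‖z‖ ∧ ‖z‖ < 2 ^ 0 * ε} = ∅ := by
        ext z; simp
      rw [this, Measure.restrict_empty, lintegral_zero_measure]
      exact zero_le
    | succ N ih =>
      have hsub : {z : ℂ | ε ≤ ‖z‖ ∧ ‖z‖ < 2 ^ (N + 1) * ε} ⊆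
          {z : ℂ | ε ≤ ‖z‖ ∧ ‖z‖ < 2 ^ N * ε} ∪
            {z : ℂ | 2 ^ N * ε ≤ ‖z‖ ∧ ‖z‖ ≤ 2 * (2 ^ N * ε)} := by
        rintro z ⟨h1, h2⟩
        rcases lt_or_ge ‖z‖ (2 ^ N * ε) with h | h
        · exact Or.inl ⟨h1, h⟩
        · refine Or.inr ⟨h, ?_⟩
          rw [pow_succ] at h2
          linarith
      refine (lintegral_mono_set hsub).trans ((lintegral_union_le _ _ _).trans
        ((add_le_add ih (lintegral_shell_le hμ q hR
          (by positivity : 0 < 2 ^ N * ε))).trans_eq ?_))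
      rw [← ENNReal.ofReal_add (by positivity) (by positivity), Real.rpow_natCast]
      congr 1
      push_cast
      rw [div_pow, mul_pow 2 (2 ^ N * ε)]
      field_simp
  refine ⟨2 * (A * 2 ^ q) / Real.log 2, by have := Real.log_pos one_lt_two; positivity, ?_⟩
  filter_upwards [eventually_ge_atTop ε, eventually_gt_atTop (4 / ε), eventually_gt_atTop 0]
    with R hR1 hR2 hR0
  obtain ⟨N, hN, hN'⟩ := exists_nat_pow_near ((one_le_div hε).2 hR1) one_lt_two
  have hsub : {z : ℂ | ε ≤ ‖z‖ ∧ ‖z‖ ≤ R} ⊆ {z : ℂ | ε ≤ ‖z‖ ∧ ‖z‖ < 2 ^ (N + 1) * ε} :=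
    fun z hz => ⟨hz.1, hz.2.trans_lt ((div_lt_iff₀ hε).1 hN')⟩
  refine (lintegral_mono_set hsub).trans ((hdy R hR0.le (N + 1)).trans
    (ENNReal.ofReal_le_ofReal ?_))
  have hlog2 := Real.log_pos one_lt_two
  -- `2 ^ (N + 1) ≤ 2 * R / ε ≤ R ^ 2`
  have h1 : ((N + 1 : ℕ) : ℝ) * Real.log 2 ≤ 2 * Real.log R := by
    rw [← Real.log_pow, ← Nat.cast_ofNat (n := 2) (R := ℝ), ← Real.log_pow]
    refine Real.log_le_log (by positivity) ?_
    have h2 := (le_div_iff₀ hε).1 hN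
    have h3 := (div_lt_iff₀ hε).1 hR2
    rw [pow_succ]
    push_cast
    have h4 : (2 : ℝ) ^ N * ε * R ≤ R * R := by gcongr
    nlinarith [pow_pos (two_pos : (0 : ℝ) < 2) N]
  calc ((N + 1 : ℕ) : ℝ) * (A * 2 ^ q * R ^ q)
      = ((N + 1 : ℕ) : ℝ) * Real.log 2 * (A * 2 ^ q * R ^ q / Real.log 2) := by field_simp
    _ ≤ 2 * Real.log R * (A * 2 ^ q * R ^ q / Real.log 2) := by gcongr
    _ = _ := by ring

end Radial

/-! ### The density of the harmonic charge -/

/-- The density of the harmonic charge of genus `m` at the point `z`, with respect to Lebesgue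
measure on the real axis. For `m = 0` this is the Poisson kernel. -/
noncomputable def balKernel (m : ℕ) (z : ℂ) (t : ℝ) : ℝ :=
  (1 / Real.pi) * ((t : ℂ) ^ m / (z ^ m * ((t : ℂ) - z))).im

theorem ofReal_sub_ne_zero {z : ℂ} (hz : z ∈ openUpper) (t : ℝ) : (t : ℂ) - z ≠ 0 := by
  intro h
  have := congrArg Complex.im h
  simp only [Complex.sub_im, Complex.ofReal_im, Complex.zero_im] at this
  have h2 : 0 < z.im := hz
  linarith

theorem ne_zero_of_mem_openUpper {z : ℂ} (hz : z ∈ openUpper) : z ≠ 0 := by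
  rintro rfl
  exact lt_irrefl (0 : ℝ) hz

theorem im_inv_ofReal_sub (z : ℂ) (t : ℝ) :
    (1 / ((t : ℂ) - z)).im = z.im / ((t - z.re) ^ 2 + z.im ^ 2) := by
  rw [one_div, Complex.inv_im, Complex.normSq_apply]
  simp only [Complex.sub_im, Complex.ofReal_im, Complex.sub_re, Complex.ofReal_re]
  congr 1 <;> ring

theorem balKernel_zero (z : ℂ) (t : ℝ) :
    balKernel 0 z t = (1 / Real.pi) * (z.im / ((t - z.re) ^ 2 + z.im ^ 2)) := by
  rw [balKernel, ← im_inv_ofReal_sub]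
  simp

theorem balKernel_succ {z : ℂ} (hz : z ∈ openUpper) (m : ℕ) (t : ℝ) :
    balKernel (m + 1) z t =
      balKernel m z t + (1 / Real.pi) * (t ^ m * (1 / z ^ (m + 1)).im) := by
  have h1 := ofReal_sub_ne_zero hz t
  have h2 := ne_zero_of_mem_openUpper hz
  have key : (t : ℂ) ^ (m + 1) / (z ^ (m + 1) * ((t : ℂ) - z)) =
      (t : ℂ) ^ m / (z ^ m * ((t : ℂ) - z)) + ((t ^ m : ℝ) : ℂ) * (1 / z ^ (m + 1)) := by
    push_cast
    field_simp
    ring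
  rw [balKernel, key, Complex.add_im, Complex.im_ofReal_mul, mul_add, balKernel]

theorem continuous_balKernel (m : ℕ) {z : ℂ} (hz : z ∈ openUpper) :
    Continuous (balKernel m z) := by
  unfold balKernel
  refine continuous_const.mul (Complex.continuous_im.comp (Continuous.div (by fun_prop)
    (by fun_prop) fun t => ?_))
  exact mul_ne_zero (pow_ne_zero _ (ne_zero_of_mem_openUpper hz)) (ofReal_sub_ne_zero hz t)

theorem measurable_balKernel (m : ℕ) : Measurable (Function.uncurry (balKernel m)) := by
  unfold balKernel Function.uncurry
  fun_prop

theorem isBounded_realTrace {B : Set ℂ} (hB : Bornology.IsBounded B) :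
    ∃ R : ℝ, 0 < R ∧ realTrace B ⊆ Icc (-R) R := by
  obtain ⟨R, hR0, hR⟩ := hB.subset_closedBall_lt 0 0
  refine ⟨R, hR0, fun t ht => ?_⟩
  have := hR ht
  rw [mem_closedBall_zero_iff, Complex.norm_real] at this
  exact abs_le.1 this

theorem measurableSet_realTrace {B : Set ℂ} (hB : MeasurableSet B) :
    MeasurableSet (realTrace B) :=
  Complex.measurable_ofReal hB

theorem harmonicCharge_eq_integral (q : ℕ) {z : ℂ} (hz : z ∈ openUpper) {B : Set ℂ}
    (hB : Bornology.IsBounded B) :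
    harmonicCharge q z B = ∫ t in realTrace B, balKernel q z t := by
  obtain ⟨R, -, hR⟩ := isBounded_realTrace hB
  have h2 := ne_zero_of_mem_openUpper hz
  have hdiff : ∀ t : ℝ, (1 / Real.pi) * (((t : ℂ) ^ q - z ^ q) / (z ^ q * ((t : ℂ) - z))).im =
      balKernel q z t - balKernel 0 z t := by
    intro t
    have h1 := ofReal_sub_ne_zero hz t
    rw [balKernel, balKernel, ← mul_sub, ← Complex.sub_im]
    congr 2
    field_simp
  have hint : ∀ m, IntegrableOn (balKernel m z) (realTrace B) := fun m =>
    ((continuous_balKernel m hz).integrableOn_Icc).mono_set hR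
  rw [harmonicCharge, harmonicMeas, ← integral_const_mul, ← integral_const_mul]
  simp only [hdiff, ← balKernel_zero]
  rw [integral_sub (hint q) (hint 0)]
  ring

theorem lintegral_poisson_le_one {z : ℂ} (hz : z ∈ openUpper) :
    ∫⁻ t, ‖balKernel 0 z t‖ₑ ≤ 1 := by
  have h : 0 < z.im := hz
  have hne : z.im.toNNReal ≠ 0 := by simpa using h
  rw [← ProbabilityTheory.lintegral_cauchyPDF_eq_one z.re hne]
  refine lintegral_mono fun t => le_of_eq ?_
  rw [ProbabilityTheory.cauchyPDF_def, ProbabilityTheory.cauchyPDFReal_def, balKernel_zero,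
    Real.enorm_of_nonneg (by have := Real.pi_pos; positivity), Real.coe_toNNReal _ h.le]
  congr 1
  field_simp

theorem abs_im_one_div_pow_le (z : ℂ) (m : ℕ) : |(1 / z ^ m).im| ≤ 1 / ‖z‖ ^ m := by
  simpa using Complex.abs_im_le_norm (1 / z ^ m)

theorem lintegral_Icc_const_mul {r c : ℝ} (hc : 0 ≤ c) :
    ∫⁻ _ in Icc (-r) r, ENNReal.ofReal c = ENNReal.ofReal (2 * r * c) := by
  rw [setLIntegral_const, Real.volume_Icc, ← ENNReal.ofReal_mul hc]
  congr 1
  ring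

/-- The part of the kernel that passes from genus `m` to genus `m + 1`. -/
theorem abs_balKernel_increment_le (m : ℕ) (z : ℂ) {r t : ℝ} (ht : t ∈ Icc (-r) r) :
    |(1 / Real.pi) * (t ^ m * (1 / z ^ (m + 1)).im)| ≤ r ^ m / ‖z‖ ^ (m + 1) := by
  have hπ : 1 / Real.pi ≤ 1 := by
    rw [div_le_one Real.pi_pos]; linarith [Real.pi_gt_three]
  have h1 : |t| ≤ r := abs_le.2 ht
  have hr : 0 ≤ r := (abs_nonneg t).trans h1
  rw [abs_mul, abs_mul, abs_pow, abs_of_pos (by positivity : 0 < 1 / Real.pi)]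
  calc 1 / Real.pi * (|t| ^ m * |(1 / z ^ (m + 1)).im|)
      ≤ 1 * (r ^ m * (1 / ‖z‖ ^ (m + 1))) := by
        gcongr
        exact abs_im_one_div_pow_le z (m + 1)
    _ = _ := by ring

theorem lintegral_balKernel_near_le {z : ℂ} (hz : z ∈ openUpper) {r : ℝ} (hr : 0 < r)
    (hzr : ‖z‖ ≤ 2 * r) (m : ℕ) :
    ∫⁻ t in Icc (-r) r, ‖balKernel m z t‖ₑ ≤
      ENNReal.ofReal ((1 + 2 * m) * (2 * r / ‖z‖) ^ m) := by
  have hz0 : 0 < ‖z‖ := norm_pos_iff.2 (ne_zero_of_mem_openUpper hz)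
  have hu : 1 ≤ 2 * r / ‖z‖ := (one_le_div hz0).2 hzr
  induction m with
  | zero => simpa using (setLIntegral_le_lintegral _ _).trans (lintegral_poisson_le_one hz)
  | succ m ih =>
    calc ∫⁻ t in Icc (-r) r, ‖balKernel (m + 1) z t‖ₑ
        ≤ ∫⁻ t in Icc (-r) r, (‖balKernel m z t‖ₑ + ENNReal.ofReal (r ^ m / ‖z‖ ^ (m + 1))) := by
          refine setLIntegral_mono' measurableSet_Icc fun t ht => ?_
          rw [balKernel_succ hz]
          refine (enorm_add_le _ _).trans (add_le_add_right ?_ _)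
          rw [Real.enorm_eq_ofReal_abs]
          exact ENNReal.ofReal_le_ofReal (abs_balKernel_increment_le m z ht)
      _ = (∫⁻ t in Icc (-r) r, ‖balKernel m z t‖ₑ) +
            ENNReal.ofReal (2 * r * (r ^ m / ‖z‖ ^ (m + 1))) := by
          rw [lintegral_add_right _ measurable_const,
            lintegral_Icc_const_mul (by positivity)]
      _ ≤ ENNReal.ofReal ((1 + 2 * m) * (2 * r / ‖z‖) ^ m) +
            ENNReal.ofReal (2 * r * (r ^ m / ‖z‖ ^ (m + 1))) := by gcongr
      _ = ENNReal.ofReal ((1 + 2 * m) * (2 * r / ‖z‖) ^ m + 2 * r * (r ^ m / ‖z‖ ^ (m + 1))) :=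
          (ENNReal.ofReal_add (by positivity) (by positivity)).symm
      _ ≤ _ := by
          refine ENNReal.ofReal_le_ofReal ?_
          have h1 : (2 * r / ‖z‖) ^ m ≤ (2 * r / ‖z‖) ^ (m + 1) :=
            pow_le_pow_right₀ hu (Nat.le_succ m)
          have h2 : 2 * r * (r ^ m / ‖z‖ ^ (m + 1)) ≤ 2 * (2 * r / ‖z‖) ^ (m + 1) := by
            calc 2 * r * (r ^ m / ‖z‖ ^ (m + 1)) = 2 * (r / ‖z‖) ^ (m + 1) := by
                  rw [div_pow]; ring
              _ ≤ _ := by gcongr; linarith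
          push_cast
          calc (1 + 2 * m) * (2 * r / ‖z‖) ^ m + 2 * r * (r ^ m / ‖z‖ ^ (m + 1))
              ≤ (1 + 2 * m) * (2 * r / ‖z‖) ^ (m + 1) + 2 * (2 * r / ‖z‖) ^ (m + 1) := by
                gcongr
            _ = _ := by ring

theorem lintegral_balKernel_far_le {z : ℂ} {r : ℝ} (hr : 0 < r) (hzr : 2 * r ≤ ‖z‖) (m : ℕ) :
    ∫⁻ t in Icc (-r) r, ‖balKernel m z t‖ₑ ≤ ENNReal.ofReal (4 * (r / ‖z‖) ^ (m + 1)) := by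
  have hz0 : 0 < ‖z‖ := by linarith
  have hπ : 1 / Real.pi ≤ 1 := by
    rw [div_le_one Real.pi_pos]; linarith [Real.pi_gt_three]
  calc ∫⁻ t in Icc (-r) r, ‖balKernel m z t‖ₑ
      ≤ ∫⁻ _ in Icc (-r) r, ENNReal.ofReal (2 * (r ^ m / ‖z‖ ^ (m + 1))) := by
        refine setLIntegral_mono' measurableSet_Icc fun t ht => ?_
        have ht : |t| ≤ r := abs_le.2 ht
        have h1 : ‖z‖ / 2 ≤ ‖(t : ℂ) - z‖ := by
          have := norm_sub_norm_le z (t : ℂ)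
          rw [Complex.norm_real, Real.norm_eq_abs, norm_sub_rev] at this
          linarith
        rw [Real.enorm_eq_ofReal_abs]
        refine ENNReal.ofReal_le_ofReal ?_
        rw [balKernel, abs_mul, abs_of_pos (by positivity : 0 < 1 / Real.pi)]
        calc 1 / Real.pi * |((t : ℂ) ^ m / (z ^ m * ((t : ℂ) - z))).im|
            ≤ 1 * ‖(t : ℂ) ^ m / (z ^ m * ((t : ℂ) - z))‖ := by
              gcongr
              exact Complex.abs_im_le_norm _
          _ = |t| ^ m / (‖z‖ ^ m * ‖(t : ℂ) - z‖) := by simp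
          _ ≤ r ^ m / (‖z‖ ^ m * (‖z‖ / 2)) := by gcongr
          _ = _ := by rw [pow_succ]; field_simp
    _ = _ := by
        rw [lintegral_Icc_const_mul (by positivity), div_pow]
        congr 1
        ring

/-- Beyond the circle of radius `r` the kernel of genus `m` has the decay of the far field. -/
theorem lintegral_balKernel_outer_le {z : ℂ} (hz : z ∈ openUpper) {r : ℝ} (hr : 0 < r)
    (hzr : r ≤ ‖z‖) (m : ℕ) :
    ∫⁻ t in Icc (-r) r, ‖balKernel m z t‖ₑ ≤
      ENNReal.ofReal ((4 + 2 * m) * 2 ^ (m + 1)) * ENNReal.ofReal ((r / ‖z‖) ^ (m + 1)) := by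
  have hz0 : 0 < ‖z‖ := by linarith
  rw [← ENNReal.ofReal_mul (by positivity)]
  rcases le_total ‖z‖ (2 * r) with h | h
  · refine (lintegral_balKernel_near_le hz hr h m).trans (ENNReal.ofReal_le_ofReal ?_)
    have h1 : (2 * r / ‖z‖) ^ m ≤ (2 * r / ‖z‖) ^ (m + 1) :=
      pow_le_pow_right₀ ((one_le_div hz0).2 h) (Nat.le_succ m)
    calc (1 + 2 * m) * (2 * r / ‖z‖) ^ m
        ≤ (4 + 2 * m) * (2 * r / ‖z‖) ^ (m + 1) := by gcongr; norm_num
      _ = _ := by rw [mul_div_assoc, mul_pow]; ring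
  · refine (lintegral_balKernel_far_le hr h m).trans (ENNReal.ofReal_le_ofReal ?_)
    gcongr
    have h1 : (1 : ℝ) ≤ 2 ^ (m + 1) := one_le_pow₀ one_le_two
    have h2 : (0 : ℝ) ≤ m := m.cast_nonneg
    nlinarith

theorem lintegral_balKernel_inner_le {z : ℂ} (hz : z ∈ openUpper) {r : ℝ} (hr : 0 < r)
    (hzr : ‖z‖ ≤ r) (m : ℕ) :
    ∫⁻ t in Icc (-r) r, ‖balKernel m z t‖ₑ ≤
      ENNReal.ofReal ((1 + 2 * m) * 2 ^ m) * ENNReal.ofReal ((r / ‖z‖) ^ m) := by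
  rw [← ENNReal.ofReal_mul (by positivity)]
  refine (lintegral_balKernel_near_le hz hr (by linarith) m).trans_eq ?_
  rw [mul_div_assoc, mul_pow, mul_assoc]

theorem measurableSet_openUpper : MeasurableSet openUpper :=
  measurableSet_lt measurable_const Complex.measurable_im

theorem measurableSet_closedUpper : MeasurableSet closedUpper :=
  measurableSet_le measurable_const Complex.measurable_im

/-! ### Absolute convergence -/

section Growth

variable {μ : Measure ℂ} {A p ε : ℝ}

theorem ae_le_norm (hε : μ (ball 0 ε) = 0) : ∀ᵐ z ∂μ, ε ≤ ‖z‖ := by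
  rw [ae_iff]
  convert hε using 2
  ext z
  simp

theorem lintegral_ball_lt_top
    (hμ : ∀ R : ℝ, 0 < R → μ (closedBall 0 R) ≤ ENNReal.ofReal (A * R ^ p)) (hε0 : 0 < ε)
    (hε : μ (ball 0 ε) = 0) (s : ℕ) {R : ℝ} (hR : 0 < R) :
    ∫⁻ z in ball 0 R, ENNReal.ofReal ((R / ‖z‖) ^ s) ∂μ < ⊤ := by
  calc ∫⁻ z in ball 0 R, ENNReal.ofReal ((R / ‖z‖) ^ s) ∂μ
      ≤ ∫⁻ _ in ball 0 R, ENNReal.ofReal ((R / ε) ^ s) ∂μ := by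
        refine lintegral_mono_ae ?_
        filter_upwards [ae_restrict_of_ae (ae_le_norm hε)] with z hz
        refine ENNReal.ofReal_le_ofReal ?_
        gcongr
    _ = ENNReal.ofReal ((R / ε) ^ s) * μ (ball 0 R) := setLIntegral_const _ _
    _ < ⊤ := ENNReal.mul_lt_top ENNReal.ofReal_lt_top
        ((measure_mono ball_subset_closedBall).trans_lt
          ((hμ R hR).trans_lt ENNReal.ofReal_lt_top))

theorem lintegral_openUpper_le {F G H : ℂ → ENNReal} {a b : ENNReal} (ha : a ≠ ⊤) (hb : b ≠ ⊤)
    (R : ℝ) (h1 : ∀ z ∈ openUpper, ‖z‖ < R → F z ≤ a * G z)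
    (h2 : ∀ z ∈ openUpper, R ≤ ‖z‖ → F z ≤ b * H z) :
    ∫⁻ z in openUpper, F z ∂μ ≤
      a * (∫⁻ z in ball 0 R, G z ∂μ) + b * ∫⁻ z in {z | R ≤ ‖z‖}, H z ∂μ := by
  have hsub : openUpper ⊆ (openUpper ∩ ball 0 R) ∪ (openUpper ∩ {z | R ≤ ‖z‖}) := by
    intro z hz
    rcases lt_or_ge ‖z‖ R with h | h
    · exact Or.inl ⟨hz, by simpa using h⟩
    · exact Or.inr ⟨hz, h⟩
  refine (lintegral_mono_set hsub).trans ((lintegral_union_le _ _ _).trans (add_le_add ?_ ?_))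
  · refine (setLIntegral_mono' (measurableSet_openUpper.inter measurableSet_ball)
      fun z hz => h1 z hz.1 (by simpa using hz.2)).trans ?_
    exact (lintegral_mono_set inter_subset_right).trans_eq (lintegral_const_mul' _ _ ha)
  · refine (setLIntegral_mono' (measurableSet_openUpper.inter
      (measurableSet_le measurable_const measurable_norm)) fun z hz => h2 z hz.1 hz.2).trans ?_
    exact (lintegral_mono_set inter_subset_right).trans_eq (lintegral_const_mul' _ _ hb)

/-- The kernel of genus `q` is integrable on the product of the upper half-plane with a bounded
interval, which is what makes Fubini's theorem available. -/
theorem integrableOn_balKernel [SFinite μ] (hA : 0 ≤ A)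
    (hμ : ∀ R : ℝ, 0 < R → μ (closedBall 0 R) ≤ ENNReal.ofReal (A * R ^ p)) (hε0 : 0 < ε)
    (hε : μ (ball 0 ε) = 0) {q : ℕ} (hpq : p < q + 1) {R : ℝ} (hR : 0 < R) :
    IntegrableOn (Function.uncurry (balKernel q)) (openUpper ×ˢ Icc (-R) R)
      (μ.prod volume) := by
  refine ⟨(measurable_balKernel q).aestronglyMeasurable, ?_⟩
  obtain ⟨C, -, hC⟩ := exists_lintegral_tail_le hA hμ (s := q + 1) (by exact_mod_cast hpq)
  rw [HasFiniteIntegral, ← Measure.prod_restrict,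
    lintegral_prod _ (measurable_balKernel q).enorm.aemeasurable]
  refine (lintegral_openUpper_le ENNReal.ofReal_ne_top ENNReal.ofReal_ne_top R
    (fun z hz hzR => lintegral_balKernel_inner_le hz hR hzR.le q)
    (fun z hz hzR => lintegral_balKernel_outer_le hz hR hzR q)).trans_lt ?_
  exact ENNReal.add_lt_top.2
    ⟨ENNReal.mul_lt_top ENNReal.ofReal_lt_top (lintegral_ball_lt_top hμ hε0 hε q hR),
      ENNReal.mul_lt_top ENNReal.ofReal_lt_top ((hC R hR).trans_lt ENNReal.ofReal_lt_top)⟩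

theorem integrableOn_im_one_div_pow
    (hμ : ∀ R : ℝ, 0 < R → μ (closedBall 0 R) ≤ ENNReal.ofReal (A * R ^ p)) (hε0 : 0 < ε)
    (hε : μ (ball 0 ε) = 0) (q : ℕ) (R : ℝ) :
    IntegrableOn (fun z : ℂ => (1 / z ^ q).im) (ball 0 R) μ := by
  have hfin : μ (ball 0 R) ≠ ⊤ := by
    refine ((measure_mono fun z hz => ?_).trans_lt ((hμ (max R 1) (by positivity)).trans_lt
      ENNReal.ofReal_lt_top)).ne
    rw [mem_ball_zero_iff] at hz
    exact mem_closedBall_zero_iff.2 (hz.le.trans (le_max_left _ _))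
  refine Measure.integrableOn_of_bounded (M := 1 / ε ^ q) hfin
    (by fun_prop : Measurable fun z : ℂ => (1 / z ^ q).im).aestronglyMeasurable ?_
  filter_upwards [ae_restrict_of_ae (ae_le_norm hε)] with z hz
  refine (abs_im_one_div_pow_le z q).trans ?_
  gcongr

end Growth

/-! ### The density of the balayage -/

/-- The density of the balayage of genus `q` on the real axis. -/
noncomputable def balDensity (q : ℕ) (ν : Charge) (t : ℝ) : ℝ :=
  ν.setIntegral openUpper fun z => balKernel q z t

/-- The kernel from which the balayage is estimated on `[-r, r]`: the genus is lowered by one at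
the points of the disc of radius `r`. For `q = 0` the truncated subtraction changes nothing. -/
noncomputable def reducedKernel (q : ℕ) (r : ℝ) (z : ℂ) (t : ℝ) : ℝ :=
  if ‖z‖ < r then balKernel (q - 1) z t else balKernel q z t

theorem measurable_reducedKernel (q : ℕ) (r : ℝ) :
    Measurable (Function.uncurry (reducedKernel q r)) :=
  Measurable.ite (measurableSet_lt measurable_fst.norm measurable_const)
    (measurable_balKernel (q - 1)) (measurable_balKernel q)

theorem balKernel_eq_reducedKernel_add (q : ℕ) (r : ℝ) {z : ℂ} (hz : z ∈ openUpper) (t : ℝ) :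
    balKernel q z t = reducedKernel q r z t +
      (ball (0 : ℂ) r).indicator (fun z => 1 / Real.pi * t ^ (q - 1) * (1 / z ^ q).im) z := by
  unfold reducedKernel
  split_ifs with h
  · rw [indicator_of_mem (mem_ball_zero_iff.2 h)]
    cases q with
    | zero => simp
    | succ m => rw [balKernel_succ hz, Nat.add_sub_cancel, mul_assoc]
  · rw [indicator_of_notMem (by simpa using h), add_zero]

/-- The integral `∫ Im z ^ (-q) dν` over the upper half of the disc of radius `r`, the only
quantity in the estimates below in which cancellation matters. -/
noncomputable def blaschkeIntegral (q : ℕ) (ν : Charge) (r : ℝ) : ℝ :=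
  ν.setIntegral (ball 0 r ∩ openUpper) fun z => (1 / z ^ q).im

section Density

variable {ν : Charge} {A p ε : ℝ}

theorem enorm_balDensity_le
    (hμ : ∀ R : ℝ, 0 < R → ν.totalVar (closedBall 0 R) ≤ ENNReal.ofReal (A * R ^ p))
    (hε0 : 0 < ε) (hε : ν.totalVar (ball 0 ε) = 0) (q : ℕ) {r t : ℝ} (ht : t ∈ Icc (-r) r) :
    ‖balDensity q ν t‖ₑ ≤ (∫⁻ z in openUpper, ‖reducedKernel q r z t‖ₑ ∂ν.totalVar) +
      ENNReal.ofReal (r ^ (q - 1) * |blaschkeIntegral q ν r|) := by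
  have h1 : |t| ≤ r := abs_le.2 ht
  have hr : 0 ≤ r := (abs_nonneg t).trans h1
  have hmeas : Measurable fun z => reducedKernel q r z t :=
    (measurable_reducedKernel q r).comp (measurable_id.prodMk measurable_const)
  rcases eq_or_ne (∫⁻ z in openUpper, ‖reducedKernel q r z t‖ₑ ∂ν.totalVar) ⊤ with htop | htop
  · rw [htop, top_add]
    exact le_top
  have hint1 : IntegrableOn (fun z => reducedKernel q r z t) openUpper ν.totalVar :=
    ⟨hmeas.aestronglyMeasurable, htop.lt_top⟩
  have hint2 : IntegrableOn ((ball (0 : ℂ) r).indicator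
      fun z => 1 / Real.pi * t ^ (q - 1) * (1 / z ^ q).im) openUpper ν.totalVar :=
    ((integrable_indicator_iff measurableSet_ball).2
      ((integrableOn_im_one_div_pow hμ hε0 hε q r).const_mul _)).integrableOn
  have hdec : balDensity q ν t = ν.setIntegral openUpper (fun z => reducedKernel q r z t) +
      1 / Real.pi * t ^ (q - 1) * blaschkeIntegral q ν r := by
    rw [blaschkeIntegral, ← ν.setIntegral_indicator_const_mul _ measurableSet_ball,
      ← ν.setIntegral_add hint1 hint2]
    simp only [balDensity, Charge.setIntegral]
    congr 1 <;> exact setIntegral_congr_fun measurableSet_openUpper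
      fun z hz => balKernel_eq_reducedKernel_add q r hz t
  rw [hdec]
  refine (enorm_add_le _ _).trans (add_le_add (ν.enorm_setIntegral_le _ _) ?_)
  rw [Real.enorm_eq_ofReal_abs]
  refine ENNReal.ofReal_le_ofReal ?_
  have hπ : 1 / Real.pi ≤ 1 := by
    rw [div_le_one Real.pi_pos]; linarith [Real.pi_gt_three]
  rw [abs_mul, abs_mul, abs_pow, abs_of_pos (by positivity : 0 < 1 / Real.pi)]
  calc 1 / Real.pi * |t| ^ (q - 1) * |blaschkeIntegral q ν r|
      ≤ 1 * r ^ (q - 1) * |blaschkeIntegral q ν r| := by gcongr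
    _ = _ := by rw [one_mul]

/-- The mass of the density on `[-r, r]`. By Tonelli's theorem it is controlled by the radial
integrals of `(r / |z|) ^ (q - 1)` inside and `(r / |z|) ^ (q + 1)` outside the disc of radius `r`;
both are of order `r ^ p` since `q ≤ p < q + 1`. -/
theorem exists_lintegral_balDensity_le (hA : 0 ≤ A)
    (hμ : ∀ R : ℝ, 0 < R → ν.totalVar (closedBall 0 R) ≤ ENNReal.ofReal (A * R ^ p))
    (hε0 : 0 < ε) (hε : ν.totalVar (ball 0 ε) = 0) {q : ℕ} (hqp : q ≤ p) (hpq : p < q + 1) :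
    ∃ C : ℝ, 0 ≤ C ∧ ∀ r : ℝ, 0 < r → ∫⁻ t in Icc (-r) r, ‖balDensity q ν t‖ₑ ≤
      ENNReal.ofReal (C * r ^ p + 2 * (r ^ q * |blaschkeIntegral q ν r|)) := by
  have hs : q - 1 = 0 ∨ ((q - 1 : ℕ) : ℝ) < p := by
    rcases q with _ | m
    · exact Or.inl rfl
    · right
      push_cast at hqp
      simp only [Nat.add_sub_cancel]
      linarith
  obtain ⟨C₁, hC₁0, hC₁⟩ := exists_lintegral_core_le hA hμ hs
  obtain ⟨C₂, hC₂0, hC₂⟩ := exists_lintegral_tail_le hA hμ (s := q + 1) (by exact_mod_cast hpq)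
  set a : ℝ := (1 + 2 * (q - 1 : ℕ)) * 2 ^ (q - 1)
  set b : ℝ := (4 + 2 * q) * 2 ^ (q + 1)
  have ha : 0 ≤ a := by positivity
  have hb : 0 ≤ b := by positivity
  refine ⟨a * C₁ + b * C₂, by positivity, fun r hr => ?_⟩
  have hrp : 0 < r ^ p := Real.rpow_pos_of_pos hr p
  have hker : ∫⁻ t in Icc (-r) r, ∫⁻ z in openUpper, ‖reducedKernel q r z t‖ₑ ∂ν.totalVar ≤
      ENNReal.ofReal ((a * C₁ + b * C₂) * r ^ p) := by
    rw [lintegral_lintegral_swap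
      ((measurable_reducedKernel q r).comp measurable_swap).enorm.aemeasurable]
    calc ∫⁻ z in openUpper, (∫⁻ t in Icc (-r) r, ‖reducedKernel q r z t‖ₑ) ∂ν.totalVar
        ≤ ENNReal.ofReal a * (∫⁻ z in ball 0 r, ENNReal.ofReal ((r / ‖z‖) ^ (q - 1)) ∂ν.totalVar)
          + ENNReal.ofReal b *
            ∫⁻ z in {z | r ≤ ‖z‖}, ENNReal.ofReal ((r / ‖z‖) ^ (q + 1)) ∂ν.totalVar := by
          refine lintegral_openUpper_le ENNReal.ofReal_ne_top ENNReal.ofReal_ne_top r ?_ ?_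
          · intro z hz hzr
            simp only [reducedKernel, if_pos hzr]
            exact lintegral_balKernel_inner_le hz hr hzr.le _
          · intro z hz hzr
            simp only [reducedKernel, if_neg hzr.not_gt]
            exact lintegral_balKernel_outer_le hz hr hzr _
      _ ≤ ENNReal.ofReal a * ENNReal.ofReal (C₁ * r ^ p) +
            ENNReal.ofReal b * ENNReal.ofReal (C₂ * r ^ p) := by
          gcongr
          · exact hC₁ r hr
          · exact hC₂ r hr
      _ = ENNReal.ofReal ((a * C₁ + b * C₂) * r ^ p) := by
          rw [← ENNReal.ofReal_mul ha, ← ENNReal.ofReal_mul hb,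
            ← ENNReal.ofReal_add (by positivity) (by positivity)]
          congr 1
          ring
  -- in genus `0` the correction term vanishes, since `Im 1 = 0`
  have hI : 2 * r * (r ^ (q - 1) * |blaschkeIntegral q ν r|) =
      2 * (r ^ q * |blaschkeIntegral q ν r|) := by
    rcases q with _ | m
    · simp [blaschkeIntegral, Charge.setIntegral]
    · rw [Nat.add_sub_cancel, pow_succ]
      ring
  calc ∫⁻ t in Icc (-r) r, ‖balDensity q ν t‖ₑ
      ≤ ∫⁻ t in Icc (-r) r, ((∫⁻ z in openUpper, ‖reducedKernel q r z t‖ₑ ∂ν.totalVar) +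
          ENNReal.ofReal (r ^ (q - 1) * |blaschkeIntegral q ν r|)) :=
        setLIntegral_mono' measurableSet_Icc fun t ht => enorm_balDensity_le hμ hε0 hε q ht
    _ = (∫⁻ t in Icc (-r) r, ∫⁻ z in openUpper, ‖reducedKernel q r z t‖ₑ ∂ν.totalVar) +
          ENNReal.ofReal (2 * (r ^ q * |blaschkeIntegral q ν r|)) := by
        rw [lintegral_add_right _ measurable_const, lintegral_Icc_const_mul (by positivity), hI]
    _ ≤ ENNReal.ofReal ((a * C₁ + b * C₂) * r ^ p) +
          ENNReal.ofReal (2 * (r ^ q * |blaschkeIntegral q ν r|)) := by gcongr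
    _ = _ := (ENNReal.ofReal_add (by positivity) (by positivity)).symm

end Density

/-! ### Existence of the balayage -/

/-- A locally integrable density on the real axis and the part of a charge outside the open upper
half-plane add up to a charge. -/
theorem exists_charge_of_density (ν : Charge) {f : ℝ → ℝ}
    (hf : ∀ R : ℝ, 0 < R → IntegrableOn f (Icc (-R) R)) :
    ∃ β : Charge, ∀ B, MeasurableSet B → Bornology.IsBounded B →
      β.val B = (∫ t in realTrace B, f t) + ν.val (B ∩ openUpperᶜ) := by
  classical
  refine ⟨{ val := fun B => if MeasurableSet B ∧ Bornology.IsBounded B then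
              (∫ t in realTrace B, f t) + ν.val (B ∩ openUpperᶜ) else 0
            val_empty := by simp [realTrace, ν.val_empty]
            val_junk := fun B hB => if_neg hB
            hasSum_iUnion := ?_ }, fun B hm hB => if_pos ⟨hm, hB⟩⟩
  intro B hm hd hB
  have hBi : ∀ i, Bornology.IsBounded (B i) := fun i => hB.subset (subset_iUnion B i)
  simp only [hm, hBi, MeasurableSet.iUnion hm, hB, and_self, if_true, iUnion_inter]
  obtain ⟨R, hR0, hR⟩ := isBounded_realTrace hB
  have htr : realTrace (⋃ i, B i) = ⋃ i, realTrace (B i) := by ext t; simp [realTrace]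
  rw [htr] at hR ⊢
  refine HasSum.add (hasSum_integral_iUnion (fun i => measurableSet_realTrace (hm i)) ?_
    ((hf R hR0).mono_set hR)) (ν.hasSum_iUnion _
      (fun i => (hm i).inter measurableSet_openUpper.compl) ?_ ?_)
  · exact fun i j hij => (hd hij).preimage _
  · exact fun i j hij => (hd hij).mono inter_subset_left inter_subset_left
  · exact hB.subset (iUnion_mono fun i => inter_subset_left)

/-- The total variation of a charge made of a density on the real axis and of the part of `ν`
outside the open upper half-plane. -/
theorem totalVar_closedBall_le_of_density {ν β : Charge} {f : ℝ → ℝ}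
    (hβ : ∀ B, MeasurableSet B → Bornology.IsBounded B →
      β.val B = (∫ t in realTrace B, f t) + ν.val (B ∩ openUpperᶜ)) (r : ℝ) :
    β.totalVar (closedBall 0 r) ≤
      ν.totalVar (closedBall 0 r) + ∫⁻ t in Icc (-r) r, ‖f t‖ₑ := by
  have hle : β.totalVar ≤ ν.totalVar +
      (volume.withDensity fun t => ‖f t‖ₑ).map ((↑) : ℝ → ℂ) := by
    refine β.totalVar_le_of_forall_enorm_le fun B hm hB => ?_
    rw [hβ B hm hB, Measure.add_apply, Measure.map_apply Complex.measurable_ofReal hm,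
      withDensity_apply _ (Complex.measurable_ofReal hm), add_comm]
    refine (enorm_add_le _ _).trans (add_le_add ?_ (enorm_integral_le_lintegral_enorm _))
    exact (ν.enorm_val_le (hm.inter measurableSet_openUpper.compl)
      (hB.subset inter_subset_left)).trans (measure_mono inter_subset_left)
  refine (hle _).trans_eq ?_
  rw [Measure.add_apply, Measure.map_apply Complex.measurable_ofReal measurableSet_closedBall,
    withDensity_apply _ (Complex.measurable_ofReal measurableSet_closedBall)]
  congr 3
  ext t
  simp [abs_le]

section Existence

variable {ν : Charge} {A p ε : ℝ}

theorem integrableOn_balDensity (hA : 0 ≤ A)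
    (hμ : ∀ R : ℝ, 0 < R → ν.totalVar (closedBall 0 R) ≤ ENNReal.ofReal (A * R ^ p))
    (hε0 : 0 < ε) (hε : ν.totalVar (ball 0 ε) = 0) {q : ℕ} (hpq : p < q + 1) (R : ℝ)
    (hR : 0 < R) : IntegrableOn (balDensity q ν) (Icc (-R) R) := by
  have key : ∀ μ : Measure ℂ, SFinite μ → μ ≤ ν.totalVar →
      IntegrableOn (fun t => ∫ z in openUpper, balKernel q z t ∂μ) (Icc (-R) R) := by
    intro μ _ hle
    have h := integrableOn_balKernel hA (fun R hR => (hle _).trans (hμ R hR)) hε0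
      (nonpos_iff_eq_zero.1 ((hle _).trans_eq hε)) hpq hR
    rw [IntegrableOn, ← Measure.prod_restrict] at h
    exact h.integral_prod_right
  exact (key _ inferInstance ν.posVar_le_totalVar).sub (key _ inferInstance ν.negVar_le_totalVar)

/-- Fubini's theorem identifies a charge with density `balDensity` as the balayage. -/
theorem isBalayage_of_balDensity (hA : 0 ≤ A)
    (hμ : ∀ R : ℝ, 0 < R → ν.totalVar (closedBall 0 R) ≤ ENNReal.ofReal (A * R ^ p))
    (hε0 : 0 < ε) (hε : ν.totalVar (ball 0 ε) = 0) {q : ℕ} (hpq : p < q + 1) {β : Charge}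
    (hβ : ∀ B, MeasurableSet B → Bornology.IsBounded B →
      β.val B = (∫ t in realTrace B, balDensity q ν t) + ν.val (B ∩ openUpperᶜ)) :
    IsBalayage q ν β := by
  intro B hm hB
  obtain ⟨R, hR0, hR⟩ := isBounded_realTrace hB
  have hcongr : ∀ z ∈ openUpper, harmonicCharge q z B = ∫ t in realTrace B, balKernel q z t :=
    fun z hz => harmonicCharge_eq_integral q hz hB
  have hint : ∀ μ : Measure ℂ, SFinite μ → μ ≤ ν.totalVar →
      Integrable (Function.uncurry (balKernel q))
        ((μ.restrict openUpper).prod (volume.restrict (realTrace B))) := by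
    intro μ _ hle
    rw [Measure.prod_restrict]
    exact (integrableOn_balKernel hA (fun R hR => (hle _).trans (hμ R hR)) hε0
      (nonpos_iff_eq_zero.1 ((hle _).trans_eq hε)) hpq hR0).mono_set (prod_mono_right hR)
  refine ⟨(integrableOn_congr_fun hcongr measurableSet_openUpper).2
    (hint _ inferInstance le_rfl).integral_prod_left, ?_⟩
  have h1 := hint _ inferInstance ν.posVar_le_totalVar
  have h2 := hint _ inferInstance ν.negVar_le_totalVar
  rw [hβ B hm hB]
  congr 1
  have h3 := integral_sub h1.integral_prod_right h2.integral_prod_right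
  simp only [Function.uncurry_apply_pair] at h3
  simp only [balDensity, Charge.setIntegral]
  rw [h3, setIntegral_congr_fun measurableSet_openUpper hcongr,
    setIntegral_congr_fun measurableSet_openUpper hcongr,
    integral_integral_swap h1, integral_integral_swap h2]

end Existence

/-! ### Growth of the Blaschke integral -/

section Blaschke

variable {ν : Charge} {A p ε : ℝ}

theorem ofReal_mul_abs_blaschkeIntegral_le (q : ℕ) (ν : Charge) {r : ℝ} (hr : 0 < r) :
    ENNReal.ofReal (r ^ q * |blaschkeIntegral q ν r|) ≤
      ∫⁻ z in ball 0 r, ENNReal.ofReal ((r / ‖z‖) ^ q) ∂ν.totalVar := by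
  rw [ENNReal.ofReal_mul (by positivity), ← Real.enorm_eq_ofReal_abs]
  calc ENNReal.ofReal (r ^ q) * ‖blaschkeIntegral q ν r‖ₑ
      ≤ ENNReal.ofReal (r ^ q) *
          ∫⁻ z in ball 0 r ∩ openUpper, ‖(1 / z ^ q).im‖ₑ ∂ν.totalVar := by
        gcongr
        exact ν.enorm_setIntegral_le _ _
    _ = ∫⁻ z in ball 0 r ∩ openUpper, ENNReal.ofReal (r ^ q) * ‖(1 / z ^ q).im‖ₑ ∂ν.totalVar :=
        (lintegral_const_mul' _ _ ENNReal.ofReal_ne_top).symm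
    _ ≤ ∫⁻ z in ball 0 r, ENNReal.ofReal (r ^ q) * ‖(1 / z ^ q).im‖ₑ ∂ν.totalVar :=
        lintegral_mono_set inter_subset_left
    _ ≤ _ := by
        refine lintegral_mono fun z => ?_
        rw [Real.enorm_eq_ofReal_abs, ← ENNReal.ofReal_mul (by positivity)]
        refine ENNReal.ofReal_le_ofReal ?_
        calc r ^ q * |(1 / z ^ q).im| ≤ r ^ q * (1 / ‖z‖ ^ q) := by
              gcongr
              exact abs_im_one_div_pow_le z q
          _ = (r / ‖z‖) ^ q := by rw [div_pow]; ring

/-- Below the critical exponent the Blaschke integral is absorbed by the main term. -/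
theorem exists_mul_abs_blaschkeIntegral_le (hA : 0 ≤ A)
    (hμ : ∀ R : ℝ, 0 < R → ν.totalVar (closedBall 0 R) ≤ ENNReal.ofReal (A * R ^ p)) {q : ℕ}
    (hqp : q < p) :
    ∃ C : ℝ, ∀ r : ℝ, 0 < r → r ^ q * |blaschkeIntegral q ν r| ≤ C * r ^ p := by
  obtain ⟨C, hC0, hC⟩ := exists_lintegral_core_le hA hμ (Or.inr hqp)
  exact ⟨C, fun r hr => (ENNReal.ofReal_le_ofReal_iff (by positivity)).1
    ((ofReal_mul_abs_blaschkeIntegral_le q ν hr).trans (hC r hr))⟩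

theorem exists_mul_abs_blaschkeIntegral_le_log (hA : 0 ≤ A)
    (hμ : ∀ R : ℝ, 0 < R → ν.totalVar (closedBall 0 R) ≤ ENNReal.ofReal (A * R ^ p))
    (hε0 : 0 < ε) (hε : ν.totalVar (ball 0 ε) = 0) {q : ℕ} (hqp : q ≤ p) :
    ∃ C : ℝ, ∀ᶠ r : ℝ in atTop,
      r ^ q * |blaschkeIntegral q ν r| ≤ C * (r ^ p * Real.log r) := by
  rcases hqp.lt_or_eq with hlt | rfl
  · obtain ⟨C, hC⟩ := exists_mul_abs_blaschkeIntegral_le hA hμ hlt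
    refine ⟨|C|, ?_⟩
    filter_upwards [eventually_ge_atTop (Real.exp 1)] with r hr
    have hr0 : 0 < r := (Real.exp_pos 1).trans_le hr
    have hlog : 1 ≤ Real.log r := (Real.le_log_iff_exp_le hr0).2 hr
    have hrp : 0 < r ^ p := Real.rpow_pos_of_pos hr0 p
    calc r ^ q * |blaschkeIntegral q ν r| ≤ C * r ^ p := hC r hr0
      _ ≤ |C| * (r ^ p * 1) := by rw [mul_one]; gcongr; exact le_abs_self C
      _ ≤ |C| * (r ^ p * Real.log r) := by gcongr
  · obtain ⟨C, hC0, hC⟩ := exists_lintegral_le_log hA hμ hε0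
    refine ⟨C, ?_⟩
    filter_upwards [hC, eventually_ge_atTop 1] with r hr hr1
    have hr0 : 0 < r := by linarith
    have hlog : 0 ≤ Real.log r := Real.log_nonneg hr1
    rw [Real.rpow_natCast]
    refine (ENNReal.ofReal_le_ofReal_iff (by positivity)).1
      ((ofReal_mul_abs_blaschkeIntegral_le q ν hr0).trans (le_trans ?_ hr))
    refine lintegral_mono' (Measure.le_iff.2 fun s hs => ?_) le_rfl
    rw [Measure.restrict_apply hs, Measure.restrict_apply hs]
    refine measure_mono_ae ?_
    filter_upwards [ae_le_norm hε] with z hz hzs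
    exact ⟨hzs.1, hz, (mem_ball_zero_iff.1 hzs.2).le⟩

theorem setIntegral_diff_ball_eq_blaschkeIntegral (q : ℕ) {r₀ : ℝ}
    (h : ν.totalVar (ball 0 r₀) = 0) (r : ℝ) :
    ν.setIntegral ((ball 0 r \ ball 0 r₀) ∩ openUpper) (fun z => (1 / z ^ q).im) =
      blaschkeIntegral q ν r :=
  ν.setIntegral_congr_set _ ((sdiff_null_ae_eq_self h).inter (ae_eq_refl _))

/-- The Blaschke condition, in which the disc removed is arbitrary and the real axis is counted,
bounds the Blaschke integral: `z ^ (-q)` is real on the real axis. -/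
theorem isBigO_blaschkeIntegral
    (hμ : ∀ R : ℝ, 0 < R → ν.totalVar (closedBall 0 R) ≤ ENNReal.ofReal (A * R ^ p))
    (hε0 : 0 < ε) (hε : ν.totalVar (ball 0 ε) = 0) {q : ℕ} {r₀ : ℝ}
    (h : (fun t : ℝ => ν.setIntegral ((ball 0 t \ ball 0 r₀) ∩ closedUpper)
      (fun z => (1 / z ^ q).im)) =O[atTop] fun _ : ℝ => (1 : ℝ)) :
    blaschkeIntegral q ν =O[atTop] fun _ : ℝ => (1 : ℝ) := by
  have hsum : ∀ᶠ t : ℝ in atTop, blaschkeIntegral q ν r₀ +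
      ν.setIntegral ((ball 0 t \ ball 0 r₀) ∩ closedUpper) (fun z => (1 / z ^ q).im) =
        blaschkeIntegral q ν t := by
    filter_upwards [eventually_ge_atTop r₀] with t ht
    have hreal : ν.setIntegral ((ball 0 t \ ball 0 r₀) ∩ closedUpper)
        (fun z => (1 / z ^ q).im) = ν.setIntegral ((ball 0 t \ ball 0 r₀) ∩ openUpper)
        (fun z => (1 / z ^ q).im) := by
      refine ν.setIntegral_eq_of_subset_of_forall_diff_eq_zero
        ((measurableSet_ball.diff measurableSet_ball).inter measurableSet_closedUpper)
        (inter_subset_inter_right _ fun z (hz : 0 < z.im) => hz.le) fun z hz => ?_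
      have hz0 : z.im = 0 := le_antisymm (not_lt.1 fun h' => hz.2 ⟨hz.1.1, h'⟩) hz.1.2
      obtain ⟨x, rfl⟩ : ∃ x : ℝ, (x : ℂ) = z := ⟨z.re, Complex.ext rfl hz0.symm⟩
      rw [← Complex.ofReal_pow, ← Complex.ofReal_one, ← Complex.ofReal_div, Complex.ofReal_im]
    have hun : ball (0 : ℂ) t ∩ openUpper =
        (ball 0 r₀ ∩ openUpper) ∪ ((ball 0 t \ ball 0 r₀) ∩ openUpper) := by
      rw [← union_inter_distrib_right, union_sdiff_cancel (ball_subset_ball ht)]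
    rw [hreal, blaschkeIntegral, blaschkeIntegral, hun]
    refine (ν.setIntegral_union ?_
      ((measurableSet_ball.diff measurableSet_ball).inter measurableSet_openUpper)
      ((integrableOn_im_one_div_pow hμ hε0 hε q r₀).mono_set inter_subset_left)
      ((integrableOn_im_one_div_pow hμ hε0 hε q t).mono_set
        (inter_subset_left.trans sdiff_subset))).symm
    exact disjoint_sdiff_right.mono inter_subset_left inter_subset_left
  exact ((isBigO_const_const _ one_ne_zero _).add h).congr' hsum EventuallyEq.rfl

end Blaschke

theorem mainTheorem5 (p : ℝ) (hp : 0 ≤ p) (ν : Charge) (hν : ν.typeAt p < ⊤)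
    (h0 : (0 : ℂ) ∉ ν.supp) :
    ∃ β : Charge, IsBalayage ⌊p⌋₊ ν β ∧
      (∃ C : ℝ, ∀ r₀ : ℝ, 0 < r₀ → Disjoint (ball (0 : ℂ) r₀) ν.supp → ∀ r : ℝ, 0 ≤ r →
        β.radVar r ≤ C * (r ^ p + r ^ ⌊p⌋₊ *
          |ν.setIntegral ((ball 0 r \ ball 0 r₀) ∩ openUpper)
            (fun z => (1 / z ^ ⌊p⌋₊).im)|)) ∧
      (β.radVar =O[atTop] fun r : ℝ => r ^ p * Real.log r) ∧
      ((∀ n : ℕ, p ≠ n) → β.typeAt p < ⊤) ∧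
      (p = ⌊p⌋₊ →
        (∃ r₀ : ℝ, 0 < r₀ ∧
          (fun t : ℝ => ν.setIntegral ((ball 0 t \ ball 0 r₀) ∩ closedUpper)
            (fun z => (1 / z ^ ⌊p⌋₊).im)) =O[atTop] fun _ : ℝ => (1 : ℝ)) →
        β.typeAt p < ⊤) := by
  obtain ⟨A, hA, hμ⟩ := ν.exists_totalVar_closedBall_le hp hν h0
  obtain ⟨ε, hε0, hd⟩ := ν.exists_ball_disjoint_supp h0
  have hε := ν.totalVar_eq_zero_of_disjoint_supp hd
  have hqp : (⌊p⌋₊ : ℝ) ≤ p := Nat.floor_le hp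
  have hpq : p < (⌊p⌋₊ : ℝ) + 1 := Nat.lt_floor_add_one p
  generalize ⌊p⌋₊ = q at hqp hpq ⊢
  obtain ⟨β, hβ⟩ := exists_charge_of_density ν
    (integrableOn_balDensity hA hμ hε0 hε hpq)
  obtain ⟨C₀, hC₀, hmass⟩ := exists_lintegral_balDensity_le hA hμ hε0 hε hqp hpq
  set C := A + C₀ + 2 with hC
  have hC0 : 0 ≤ C := by positivity
  have hmain : ∀ r : ℝ, 0 < r →
      β.radVar r ≤ C * (r ^ p + r ^ q * |blaschkeIntegral q ν r|) := by
    intro r hr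
    have hrp : 0 < r ^ p := Real.rpow_pos_of_pos hr p
    refine (ENNReal.ofReal_le_ofReal_iff (by positivity)).1 ?_
    rw [β.ofReal_radVar]
    refine (totalVar_closedBall_le_of_density hβ r).trans
      ((add_le_add (hμ r hr) (hmass r hr)).trans ?_)
    rw [← ENNReal.ofReal_add (by positivity) (by positivity)]
    refine ENNReal.ofReal_le_ofReal ?_
    have h1 : 0 ≤ (A + C₀) * (r ^ q * |blaschkeIntegral q ν r|) := by positivity
    rw [hC]
    linarith
  refine ⟨β, isBalayage_of_balDensity hA hμ hε0 hε hpq hβ, ⟨C, fun r₀ hr₀ hd₀ r hr => ?_⟩,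
    ?_, fun hn => ?_, fun hpq' ⟨r₀, _, hbl⟩ => ?_⟩
  · rw [setIntegral_diff_ball_eq_blaschkeIntegral q (ν.totalVar_eq_zero_of_disjoint_supp hd₀) r]
    rcases hr.eq_or_lt with rfl | hr
    · -- neither `ν` nor the density charges the origin
      have h1 : β.totalVar (closedBall 0 0) = 0 := by
        refine nonpos_iff_eq_zero.1 ((totalVar_closedBall_le_of_density hβ 0).trans_eq ?_)
        rw [measure_mono_null (closedBall_subset_ball hε0) hε]
        simp
      rw [Charge.radVar, Measure.real, h1, ENNReal.toReal_zero]
      have := Real.rpow_nonneg le_rfl p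
      positivity
    · exact hmain r hr
  · obtain ⟨D, hD⟩ := exists_mul_abs_blaschkeIntegral_le_log hA hμ hε0 hε hqp
    refine IsBigO.of_bound (C * (1 + D)) ?_
    filter_upwards [hD, eventually_ge_atTop (Real.exp 1)] with r hr hr1
    have hr0 : 0 < r := (Real.exp_pos 1).trans_le hr1
    have hlog : 1 ≤ Real.log r := (Real.le_log_iff_exp_le hr0).2 hr1
    have hrp : 0 < r ^ p := Real.rpow_pos_of_pos hr0 p
    rw [Real.norm_of_nonneg (β.radVar_nonneg r), Real.norm_of_nonneg (by positivity)]
    calc β.radVar r ≤ C * (r ^ p + r ^ q * |blaschkeIntegral q ν r|) := hmain r hr0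
      _ ≤ C * (r ^ p * Real.log r + D * (r ^ p * Real.log r)) := by
          gcongr
          exact le_mul_of_one_le_right hrp.le hlog
      _ = _ := by ring
  · obtain ⟨D, hD⟩ :=
      exists_mul_abs_blaschkeIntegral_le hA hμ (lt_of_le_of_ne hqp (hn q).symm)
    refine β.typeAt_lt_top_of_eventually_le (A := C * (1 + D)) ?_
    filter_upwards [eventually_gt_atTop 0] with r hr
    calc β.radVar r ≤ C * (r ^ p + r ^ q * |blaschkeIntegral q ν r|) := hmain r hr
      _ ≤ C * (r ^ p + D * r ^ p) :=
          mul_le_mul_of_nonneg_left (add_le_add le_rfl (hD r hr)) hC0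
      _ = _ := by ring
  · obtain ⟨D, hD⟩ := (isBigO_blaschkeIntegral hμ hε0 hε hbl).bound
    refine β.typeAt_lt_top_of_eventually_le (A := C * (1 + D)) ?_
    filter_upwards [hD, eventually_gt_atTop 0] with r hr hr0
    rw [norm_one, mul_one, Real.norm_eq_abs] at hr
    have hrp : r ^ p = r ^ q := by rw [hpq', Real.rpow_natCast]
    calc β.radVar r ≤ C * (r ^ p + r ^ q * |blaschkeIntegral q ν r|) := hmain r hr0
      _ ≤ C * (r ^ p + r ^ q * D) := by gcongr
      _ = _ := by rw [hrp]; ring
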